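/- Notation. Let $1\le n<d$ be integers, write $\mathbb R^d=\mathbb R^n\times\mathbb R^{d-n}$, and let $B(x,r)$ and $U(x,r)$ be the closed and open balls. $\mathcal H^n$ is $n$-dimensional Hausdorff measure. $G(d,n)$ is the set of $n$-dimensional linear subspaces of $\mathbb R^d$ with the metric $\|V-W\|=\|\pi_V-\pi_W\|$ (operator norm), where $\pi_V$ is the orthogonal projection onto $V$; $\gamma_{d,n}$ is the $O(d)$-invariant Borel probability measure on $G(d,n)$, and $B(\mathbb R^n,\kappa)\subset G(d,n)$ is the closed ball of radius $\kappa$ about $\mathbb R^n$. A set $E\subset\mathbb R^d$ is $n$-Ahlfors--David regular ($n$-ADR) with constants $0<C_1\le C_2<\infty$ if $C_1r^n\le\mathcal H^n(E\cap B(x,r))\le C_2r^n$ for all $x\in E$ and all real $0<r\le\operatorname{diam}(E)$. For $\theta\in(0,1)$ and $0<r<R$ put $$X(x,\theta,R,r)=\{y\in\mathbb R^d:\ |\pi_{\mathbb R^n}(x-y)|\le\theta|x-y|\}\cap\big(B(x,R)\setminus U(x,r)\big).$$ Lemma. For every $d$ and every $\kappa>0$ there is $\theta_0=\theta_0(\kappa,d)\in(0,1)$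 such that for all $1\le n<d$, all $0<C_1\le C_2<\infty$ and all $0\le C<\infty$ there are $M_0\in\mathbb N$ and $A\in(0,\infty)$, depending only on $\kappa,C,n,d,C_1,C_2$, with the following property. Let $E_0\subset\mathbb R^d$ be $n$-ADR with constants $C_1,C_2$, and let $E_1\subset E_0\cap B(0,1)$ be an $\mathcal H^n$-measurable set such that (i) $\mathcal H^n(E_1)\ge\kappa$, and (ii) $\pi_{V\sharp}\mathcal H^n|_{E_1}\in L^2(V)$ for $\gamma_{d,n}$-a.e. $V\in B(\mathbb R^n,\kappa)$, that is, this measure is absolutely continuous with respect to $\mathcal H^n$ on $V$ with square-integrable density, and $$\int_{B(\mathbb R^n,\kappa)}\|\pi_{V\sharp}\mathcal H^n|_{E_1}\|_{L^2(V)}^2\,d\gamma_{d,n}(V)\le C.$$ Then there is an $\mathcal H^n$-measurable set $E_2\subset E_1$ such that $A^{-1}\le\mathcal H^n(E_2)\le A$ and, for every $x\in E_2$, $$\#\{j\in\mathbb Z:\ X(x,\theta_0,2^{-j},2^{-j-1})\cap E_2\ne\emptyset\}\le M_0.$$ -/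

import Mathlib

open MeasureTheory Metric Set
open scoped ENNReal NNReal

noncomputable section

namespace BigPieces

/-- The Grassmannian `G(d,k)` of all `k`-dimensional linear subspaces of `ℝ^d`. -/
def Grassmannian (d k : ℕ) : Type :=
  {V : Submodule ℝ (EuclideanSpace ℝ (Fin d)) // Module.finrank ℝ V = k}

/-- The orthogonal projection `π_V`, as an operator on `ℝ^d`. -/
def Grassmannian.proj {d k : ℕ} (V : Grassmannian d k) :
    EuclideanSpace ℝ (Fin d) →L[ℝ] EuclideanSpace ℝ (Fin d) :=
  V.1.starProjection

theorem Grassmannian.proj_injective (d k : ℕ) :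
    Function.Injective (Grassmannian.proj : Grassmannian d k → _) := by
  intro V W h
  apply Subtype.ext
  have h' : V.1.starProjection = W.1.starProjection := h
  rw [← Submodule.range_starProjection V.1, ← Submodule.range_starProjection W.1, h']

/-- The metric `‖V - W‖ = ‖π_V - π_W‖` (operator norm). -/
instance (d k : ℕ) : MetricSpace (Grassmannian d k) :=
  MetricSpace.induced Grassmannian.proj (Grassmannian.proj_injective d k) inferInstance

theorem Grassmannian.dist_eq {d k : ℕ} (V W : Grassmannian d k) :
    dist V W = ‖V.1.starProjection - W.1.starProjection‖ :=
  dist_eq_norm V.proj W.proj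

instance (d k : ℕ) : MeasurableSpace (Grassmannian d k) := borel _

instance (d k : ℕ) : BorelSpace (Grassmannian d k) := ⟨rfl⟩

/-- The subspace `ℝ^n` of `ℝ^d = ℝ^n × ℝ^{d-n}`, spanned by the first `n` coordinate vectors. -/
def coordPlane {d n : ℕ} (h : n ≤ d) : Grassmannian d n :=
  ⟨Submodule.span ℝ
      (range fun i : Fin n => EuclideanSpace.single (Fin.castLE h i) (1 : ℝ)), by
    have hli : LinearIndependent ℝ
        (fun i : Fin n => (EuclideanSpace.single (Fin.castLE h i) (1 : ℝ) :
          EuclideanSpace ℝ (Fin d))) := by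
      have h0 := (EuclideanSpace.basisFun (Fin d) ℝ).orthonormal.linearIndependent.comp
        (Fin.castLE h) (Fin.castLE_injective h)
      have h1 : (fun i : Fin n => (EuclideanSpace.single (Fin.castLE h i) (1 : ℝ) :
          EuclideanSpace ℝ (Fin d))) =
          (EuclideanSpace.basisFun (Fin d) ℝ) ∘ (Fin.castLE h) := by
        funext i
        simp
      rw [h1]
      exact h0
    simpa using finrank_span_eq_card hli⟩

/-- The orthogonal group `O(d)`. -/
abbrev OrthGroup (d : ℕ) : Type :=
  unitary (EuclideanSpace ℝ (Fin d) →L[ℝ] EuclideanSpace ℝ (Fin d))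

instance (d : ℕ) : ContinuousStar (EuclideanSpace ℝ (Fin d) →L[ℝ] EuclideanSpace ℝ (Fin d)) :=
  ⟨(ContinuousLinearMap.adjoint (𝕜 := ℝ) (E := EuclideanSpace ℝ (Fin d))
    (F := EuclideanSpace ℝ (Fin d))).continuous⟩

instance (d : ℕ) : CompactSpace (OrthGroup d) := by
  have : ProperSpace (EuclideanSpace ℝ (Fin d) →L[ℝ] EuclideanSpace ℝ (Fin d)) :=
    FiniteDimensional.proper ℝ _
  have key : IsCompact
      (unitary (EuclideanSpace ℝ (Fin d) →L[ℝ] EuclideanSpace ℝ (Fin d)) :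
        Set (EuclideanSpace ℝ (Fin d) →L[ℝ] EuclideanSpace ℝ (Fin d))) := by
    refine Metric.isCompact_of_isClosed_isBounded isClosed_unitary ?_
    refine (Metric.isBounded_closedBall (x := 0) (r := 1)).subset ?_
    intro g hg
    rw [mem_closedBall_zero_iff]
    refine ContinuousLinearMap.opNorm_le_bound _ zero_le_one fun x => ?_
    rw [one_mul]
    exact (ContinuousLinearMap.norm_map_of_mem_unitary hg x).le
  exact isCompact_iff_compactSpace.mp key

/-- The invariant (Haar) probability measure on `O(d)`. -/
def orthHaar (d : ℕ) : Measure (OrthGroup d) := Measure.haarMeasure ⊤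

/-- The action `V ↦ g V` of `O(d)` on `G(d,k)`. -/
def rotate {d k : ℕ} (V : Grassmannian d k) (g : OrthGroup d) : Grassmannian d k :=
  ⟨V.1.map ((Unitary.linearIsometryEquiv g).toLinearEquiv :
      EuclideanSpace ℝ (Fin d) →ₗ[ℝ] EuclideanSpace ℝ (Fin d)), by
    rw [LinearEquiv.finrank_map_eq]
    exact V.2⟩

/-- The `O(d)`-invariant Borel probability measure `γ_{d,n}` on `G(d,n)`:
`γ_{d,n}(A)` is the Haar measure of `{g ∈ O(d) : g ℝ^n ∈ A}`. -/
def grassmannMeasure {d n : ℕ} (h : n ≤ d) : Measure (Grassmannian d n) :=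
  (orthHaar d).map (rotate (coordPlane h))

theorem rotate_continuous {d k : ℕ} (V : Grassmannian d k) : Continuous (rotate V) := by
  refine continuous_induced_rng.mpr ?_
  have h : Grassmannian.proj ∘ rotate V = fun g : OrthGroup d =>
      (g : EuclideanSpace ℝ (Fin d) →L[ℝ] EuclideanSpace ℝ (Fin d)) * V.1.starProjection *
        star (g : EuclideanSpace ℝ (Fin d) →L[ℝ] EuclideanSpace ℝ (Fin d)) := by
    funext g
    ext1 x
    exact Submodule.starProjection_map_apply (Unitary.linearIsometryEquiv g) V.1 x
  rw [h]
  fun_prop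

instance {d n : ℕ} (h : n ≤ d) : IsProbabilityMeasure (grassmannMeasure h) := by
  have : IsProbabilityMeasure (orthHaar d) := ⟨by
    simpa [orthHaar] using Measure.haarMeasure_self
      (K₀ := (⊤ : TopologicalSpace.PositiveCompacts (OrthGroup d)))⟩
  exact Measure.isProbabilityMeasure_map (rotate_continuous _).measurable.aemeasurable

/-- `E` is `n`-Ahlfors-David regular with ADR constants `C₁, C₂`. -/
def IsADR {d : ℕ} (n : ℕ) (C₁ C₂ : ℝ) (E : Set (EuclideanSpace ℝ (Fin d))) : Prop :=
  ∀ x ∈ E, ∀ r : ℝ, 0 < r → ENNReal.ofReal r ≤ ediam E →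
    ENNReal.ofReal (C₁ * r ^ n) ≤ Measure.hausdorffMeasure (n : ℝ) (E ∩ closedBall x r) ∧
    Measure.hausdorffMeasure (n : ℝ) (E ∩ closedBall x r) ≤ ENNReal.ofReal (C₂ * r ^ n)

/-- The push-forward `π_{V♯} (ℋⁿ|_E)`, a measure on `V`. -/
def projMeasure {d n : ℕ} (E : Set (EuclideanSpace ℝ (Fin d))) (V : Grassmannian d n) :
    Measure V.1 :=
  ((Measure.hausdorffMeasure (n : ℝ)).restrict E).map V.1.orthogonalProjectionOnto

/-- The square of the `L²(V)`-norm of (the `ℋⁿ`-density of) `π_{V♯} (ℋⁿ|_E)`. -/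
def projL2NormSq {d n : ℕ} (E : Set (EuclideanSpace ℝ (Fin d))) (V : Grassmannian d n) : ℝ≥0∞ :=
  ∫⁻ v, ((projMeasure E V).rnDeriv (Measure.hausdorffMeasure (n : ℝ)) v) ^ 2
    ∂(Measure.hausdorffMeasure (n : ℝ) : Measure V.1)

/-- `π_{V♯} (ℋⁿ|_E) ∈ L²(V)`: the measure is absolutely continuous with respect to `ℋⁿ` on `V`,
with square-integrable density. -/
def ProjMemL2 {d n : ℕ} (E : Set (EuclideanSpace ℝ (Fin d))) (V : Grassmannian d n) : Prop :=
  projMeasure E V ≪ Measure.hausdorffMeasure (n : ℝ) ∧ projL2NormSq E V < ∞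

/-- The cone `X(x,V,α) = {y : |π_{V^⊥}(x - y)| ≤ α |x - y|}`. -/
def cone {d : ℕ} (x : EuclideanSpace ℝ (Fin d)) (V : Submodule ℝ (EuclideanSpace ℝ (Fin d)))
    (α : ℝ) : Set (EuclideanSpace ℝ (Fin d)) :=
  {y | ‖Vᗮ.starProjection (x - y)‖ ≤ α * ‖x - y‖}

/-- The truncated cone `X(x,V,α,R,r) = X(x,V,α) ∩ [B(x,R) \ U(x,r)]`. -/
def coneAnnulus {d : ℕ} (x : EuclideanSpace ℝ (Fin d))
    (V : Submodule ℝ (EuclideanSpace ℝ (Fin d))) (α R r : ℝ) : Set (EuclideanSpace ℝ (Fin d)) :=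
  cone x V α ∩ (closedBall x R \ ball x r)

/-- The `n`-dimensional `(θ,M)`-property of `E ⊆ ℝ^d`, for the cones
`X(x,θ,R,r) = X(x,ℝ^{d-n},θ,R,r)`, where `ℝ^{d-n} = (ℝ^n)^⊥`. -/
def ThetaMProperty {d n : ℕ} (h : n ≤ d) (θ : ℝ) (M : ℕ)
    (E : Set (EuclideanSpace ℝ (Fin d))) : Prop :=
  ∀ x ∈ E,
    {j : ℤ | (coneAnnulus x (coordPlane h).1ᗮ θ ((2 : ℝ) ^ (-j)) ((2 : ℝ) ^ (-j - 1)) ∩ E).Nonempty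
      }.encard ≤ M

end BigPieces

end

/-! The proof bounds a conical energy. Let `μ` be `ℋⁿ` restricted to `E₁`. If `z` lies in a narrow
cone around `(ℝⁿ)^⊥`, the planes `V` near `ℝⁿ` with `|π_V z| ≤ δ` have `γ`-measure at least `c
(δ/|z|)ⁿ` (`exists_le_grassmannMeasure_nearPlanes`). Put `z = x - y`, integrate over `μ × μ` and
apply Fubini: the result is the `γ`-average of `(μ × μ){|π_V(x - y)| ≤ δ}`, which Schur's test
bounds by a constant times `δⁿ` times the average of `‖π_V♯ μ‖₂²`. The powers of `δ` cancel, and `δ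
→ 0` bounds the integral of `|x - y|⁻ⁿ` over pairs in cone position
(`exists_lintegral_conePairs_le`).

By Chebyshev, most points of `E₁` have pointwise energy below some `M`; they form `E'`. A Vitali
covering shows that `E'` has low density at some scale only around few of its points
(`IsADR.measure_lowDensityPoints_le`); removing these leaves `E₂`. If the cone at `x ∈ E₂` meets
`E₂` in `y` at scale `2⁻ʲ`, a ball around `y` of radius comparable to `2⁻ʲ` lies in a slightly wider
cone and carries mass comparable to `2⁻ʲⁿ`, so that scale adds a fixed amount to the energy at `x`.
As scales overlap boundedly and the energy is below `M`, there are boundedly many of them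
(`encard_scales_le`). -/

/-! ### Rotations close to the identity. -/

section Rotations

variable {F : Type*} [NormedAddCommGroup F] [InnerProductSpace ℝ F]

theorem norm_inner_smul_sub_inner_smul_le {a b : F} (ha : ‖a‖ = 1) (hb : ‖b‖ = 1) (y : F) :
    ‖inner ℝ a y • a - inner ℝ b y • b‖ ≤ 2 * ‖a - b‖ * ‖y‖ := by
  have h : inner ℝ a y • a - inner ℝ b y • b
      = inner ℝ (a - b) y • a + inner ℝ b y • (a - b) := by
    rw [inner_sub_left]; module
  rw [h]
  refine (norm_add_le _ _).trans ?_
  rw [norm_smul, norm_smul, ha]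
  have h1 := norm_inner_le_norm (𝕜 := ℝ) (a - b) y
  have h2 := norm_inner_le_norm (𝕜 := ℝ) b y
  rw [hb] at h2
  nlinarith [norm_nonneg (a - b)]

/-- A unit vector can be rotated to a nearby one by an isometry close to the identity. -/
theorem exists_linearIsometryEquiv_near_refl {a b : F} (ha : ‖a‖ = 1) (hb : ‖b‖ = 1)
    (hab : ‖a - b‖ ≤ 1) :
    ∃ h : F ≃ₗᵢ[ℝ] F, h a = b ∧ ∀ x, ‖h x - x‖ ≤ 4 * ‖a - b‖ * ‖x‖ := by
  have hc1 : 1 ≤ ‖a + b‖ := by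
    have : (2 : ℝ) = ‖(a + b) + (a - b)‖ := by
      rw [show (a + b) + (a - b) = (2 : ℝ) • a by module, norm_smul, ha]; norm_num
    have := norm_add_le (a + b) (a - b)
    linarith
  have hc0 : ‖a + b‖ ≠ 0 := by positivity
  set c : F := ‖a + b‖⁻¹ • (a + b) with hc
  have hcn : ‖c‖ = 1 := by
    rw [hc, norm_smul, norm_inv, norm_norm, inv_mul_cancel₀ hc0]
  have hac : ‖a - c‖ ≤ ‖a - b‖ := by
    have h1 : ‖a - (1 / 2 : ℝ) • (a + b)‖ = 1 / 2 * ‖a - b‖ := by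
      rw [show a - (1 / 2 : ℝ) • (a + b) = (1 / 2 : ℝ) • (a - b) by module, norm_smul]
      norm_num
    have h2 : ‖(1 / 2 : ℝ) • (a + b) - c‖ = |1 / 2 * ‖a + b‖ - 1| := by
      have : (1 / 2 : ℝ) • (a + b) - c = (1 / 2 * ‖a + b‖ - 1) • c := by
        rw [hc, smul_smul, ← sub_smul]
        congr 1
        field_simp
      rw [this, norm_smul, hcn, mul_one, Real.norm_eq_abs]
    have h3 : |1 / 2 * ‖a + b‖ - 1| ≤ 1 / 2 * ‖a - b‖ := by
      have h4 := abs_norm_sub_norm_le ((1 / 2 : ℝ) • (a + b)) a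
      rw [norm_sub_rev, h1, norm_smul, ha] at h4
      norm_num at h4 ⊢
      exact h4
    calc ‖a - c‖ = ‖(a - (1 / 2 : ℝ) • (a + b)) + ((1 / 2 : ℝ) • (a + b) - c)‖ := by
          congr 1; abel
      _ ≤ _ := norm_add_le _ _
      _ ≤ _ := by rw [h1, h2]; linarith
  have hspan : (ℝ ∙ (-a - b)) = (ℝ ∙ c) := by
    have : c = (-‖a + b‖⁻¹) • (-a - b) := by rw [hc]; module
    rw [this, Submodule.span_singleton_smul_eq]
    exact (neg_ne_zero.2 (inv_ne_zero hc0)).isUnit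
  -- Composite of the reflections in `a^⊥` and `c^⊥`, with `c` the normalized midpoint: `a ↦ -a ↦
  -- b`, since `-a - b` is parallel to `c`. With `y` the first reflection of `x`, the displacement
  -- of `x` is the difference of the two reflections at `y`, small because `a` and `c` are close.
  refine ⟨(ℝ ∙ a)ᗮ.reflection.trans (ℝ ∙ c)ᗮ.reflection, ?_, fun x => ?_⟩
  · have h1 : (ℝ ∙ a)ᗮ.reflection a = -a := by
      rw [Submodule.reflection_orthogonal_apply, Submodule.reflection_mem_subspace_eq_self
        (Submodule.mem_span_singleton_self a)]
    rw [LinearIsometryEquiv.trans_apply, h1]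
    have := Submodule.reflection_sub (v := -a) (w := b) (by rw [norm_neg, ha, hb])
    simp only [hspan] at this
    exact this
  · rw [LinearIsometryEquiv.trans_apply]
    obtain ⟨y, hy⟩ : ∃ y, (ℝ ∙ a)ᗮ.reflection x = y := ⟨_, rfl⟩
    have hx : x = (ℝ ∙ a)ᗮ.reflection y := by rw [← hy, Submodule.reflection_reflection]
    have hyx : ‖x‖ = ‖y‖ := by rw [hx, LinearIsometryEquiv.norm_map]
    rw [hy, hyx, hx]
    rw [Submodule.reflection_orthogonal_apply, Submodule.reflection_orthogonal_apply,
      Submodule.reflection_apply, Submodule.reflection_apply,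
      Submodule.starProjection_unit_singleton ℝ hcn, Submodule.starProjection_unit_singleton ℝ ha]
    rw [show -(2 • inner ℝ c y • c - y) - -(2 • inner ℝ a y • a - y)
      = (2 : ℝ) • (inner ℝ a y • a - inner ℝ c y • c) by module, norm_smul]
    have := norm_inner_smul_sub_inner_smul_le ha hcn y
    norm_num
    nlinarith [norm_nonneg y]

/-- An isometry close to the identity moves a subspace only little. -/
theorem norm_starProjection_map_sub_le [FiniteDimensional ℝ F] {K : Submodule ℝ F}
    (h : F ≃ₗᵢ[ℝ] F) {η : ℝ} (hη : 0 ≤ η) (hh : ∀ x, ‖h x - x‖ ≤ η * ‖x‖) :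
    ‖(K.map (h.toLinearEquiv : F →ₗ[ℝ] F)).starProjection - K.starProjection‖ ≤ 2 * η := by
  refine ContinuousLinearMap.opNorm_le_bound _ (by positivity) fun x => ?_
  have h0 : (K.map (h.toLinearEquiv : F →ₗ[ℝ] F)).starProjection x
      = h (K.starProjection (h.symm x)) := Submodule.starProjection_map_apply h K x
  rw [_root_.sub_apply, h0]
  have hsymm : ‖h.symm x‖ = ‖x‖ := LinearIsometryEquiv.norm_map _ _
  have h1 : ‖h (K.starProjection (h.symm x)) - K.starProjection (h.symm x)‖ ≤ η * ‖x‖ := by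
    refine (hh _).trans (mul_le_mul_of_nonneg_left ?_ hη)
    exact (K.norm_starProjection_apply_le _).trans hsymm.le
  have h2 : ‖K.starProjection (h.symm x) - K.starProjection x‖ ≤ η * ‖x‖ := by
    rw [← map_sub]
    refine (K.norm_starProjection_apply_le _).trans ?_
    rw [norm_sub_rev]
    simpa [hsymm] using hh (h.symm x)
  calc _ ≤ ‖h (K.starProjection (h.symm x)) - K.starProjection (h.symm x)‖
        + ‖K.starProjection (h.symm x) - K.starProjection x‖ :=
          norm_sub_le_norm_sub_add_norm_sub _ _ _
    _ ≤ _ := by linarith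

end Rotations

/-! ### Measure of the planes near `ℝⁿ` that are almost orthogonal to a vector. -/

namespace BigPieces

section GrassmannMeasure

instance (d k : ℕ) : SecondCountableTopology (Grassmannian d k) :=
  (Topology.IsInducing.induced (Grassmannian.proj (d := d) (k := k))).secondCountableTopology

instance (d : ℕ) : (orthHaar d).IsHaarMeasure := by
  unfold orthHaar; infer_instance

instance (d : ℕ) : IsProbabilityMeasure (orthHaar d) :=
  ⟨by simpa [orthHaar] using Measure.haarMeasure_self
          (K₀ := (⊤ : TopologicalSpace.PositiveCompacts (OrthGroup d)))⟩

variable {d n : ℕ}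

theorem rotate_one (V : Grassmannian d n) : rotate V 1 = V := by
  apply Grassmannian.proj_injective
  ext1 x
  exact (Submodule.starProjection_map_apply (Unitary.linearIsometryEquiv 1) V.1 x).trans
    (by rw [map_one]; rfl)

theorem starProjection_rotate (V : Grassmannian d n) (g : OrthGroup d)
    (x : EuclideanSpace ℝ (Fin d)) :
    (rotate V g).1.starProjection x = Unitary.linearIsometryEquiv g
      (V.1.starProjection ((Unitary.linearIsometryEquiv g).symm x)) :=
  Submodule.starProjection_map_apply (Unitary.linearIsometryEquiv g) V.1 x

theorem rotate_mul (V : Grassmannian d n) (h g : OrthGroup d) :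
    rotate V (h * g) = rotate (rotate V g) h := by
  apply Grassmannian.proj_injective
  ext1 x
  change (rotate V (h * g)).1.starProjection x = (rotate (rotate V g) h).1.starProjection x
  rw [starProjection_rotate, starProjection_rotate, starProjection_rotate, map_mul]
  rfl

theorem continuous_starProjection_apply :
    Continuous fun p : Grassmannian d n × EuclideanSpace ℝ (Fin d) => p.1.1.starProjection p.2 := by
  have : Continuous (Grassmannian.proj (d := d) (k := n)) := continuous_induced_dom
  exact (this.comp continuous_fst).clm_apply continuous_snd

theorem norm_starProjection_le_add_dist (V W : Grassmannian d n) (z : EuclideanSpace ℝ (Fin d)) :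
    ‖V.1.starProjection z‖ ≤ ‖W.1.starProjection z‖ + dist V W * ‖z‖ := by
  rw [Grassmannian.dist_eq]
  have h1 := (V.1.starProjection - W.1.starProjection).le_opNorm z
  have h2 := norm_add_le (W.1.starProjection z) ((V.1.starProjection - W.1.starProjection) z)
  rw [_root_.sub_apply, add_sub_cancel] at h2
  rw [_root_.sub_apply] at h1
  linarith

/-- The planes near `ℝⁿ` onto which `z` projects to a point of norm at most `δ`. -/
def nearPlanes (h : n ≤ d) (κ δ : ℝ) (z : EuclideanSpace ℝ (Fin d)) : Set (Grassmannian d n) :=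
  {V | dist V (coordPlane h) ≤ κ ∧ ‖V.1.starProjection z‖ ≤ δ}

theorem isClosed_nearPlanes (h : n ≤ d) (κ δ : ℝ) (z : EuclideanSpace ℝ (Fin d)) :
    IsClosed (nearPlanes h κ δ z) := by
  have h1 : Continuous fun V : Grassmannian d n => dist V (coordPlane h) := by fun_prop
  exact (isClosed_le h1 continuous_const).inter (isClosed_le
    (continuous_starProjection_apply.comp (Continuous.prodMk_left z)).norm continuous_const)

theorem grassmannMeasure_preimage_rotate (h : n ≤ d) (g : OrthGroup d) {S : Set (Grassmannian d n)}
    (hS : MeasurableSet S) (hS' : MeasurableSet {V | rotate V g ∈ S}) :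
    grassmannMeasure h {V | rotate V g ∈ S} = grassmannMeasure h S := by
  have hm := (rotate_continuous (coordPlane h)).measurable
  rw [grassmannMeasure, Measure.map_apply hm hS, Measure.map_apply hm hS',
    ← measure_preimage_mul (orthHaar d) g (rotate (coordPlane h) ⁻¹' S)]
  congr 1
  ext g'
  simp [rotate_mul]

/-- Planes almost orthogonal to `w` are no more frequent than those almost orthogonal to a nearby
direction `z`, if the distance to `ℝⁿ` is allowed to be larger. -/
theorem grassmannMeasure_nearPlanes_le (h : n ≤ d) {κ δ ρ : ℝ} (hρ : ρ ≤ κ / 32)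
    (hρ' : ρ ≤ 1 / 4) {z w : EuclideanSpace ℝ (Fin d)} (hz : ‖z‖ = 1) (hw : ‖w - z‖ ≤ ρ) :
    grassmannMeasure h (nearPlanes h (κ / 2) (δ / 2) w) ≤
      grassmannMeasure h (nearPlanes h κ δ z) := by
  -- The final inequality `δ / 2 ≤ ‖w‖ * δ` needs `δ ≥ 0`, besides `‖w‖ ≥ 3 / 4`.
  rcases lt_or_ge δ 0 with hδ | hδ
  · have : nearPlanes h (κ / 2) (δ / 2) w = ∅ := by
      ext V
      simp only [nearPlanes, mem_ofPred_eq, mem_empty_iff_false, iff_false, not_and, not_le]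
      intro _
      exact lt_of_lt_of_le (by linarith) (norm_nonneg _)
    simp [this]
  have hwz : |‖w‖ - 1| ≤ ρ := by
    rw [← hz]; exact (abs_norm_sub_norm_le w z).trans hw
  obtain ⟨hw1, hw2⟩ := abs_le.1 hwz
  have hw0 : 0 < ‖w‖ := by linarith
  set a : EuclideanSpace ℝ (Fin d) := ‖w‖⁻¹ • w with ha
  have han : ‖a‖ = 1 := by rw [ha, norm_smul, norm_inv, norm_norm, inv_mul_cancel₀ hw0.ne']
  have haw : ‖a - w‖ ≤ ρ := by
    have : a - w = (1 - ‖w‖) • a := by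
      rw [ha, sub_smul, one_smul, smul_smul, mul_inv_cancel₀ hw0.ne', one_smul]
    rw [this, norm_smul, han, mul_one, Real.norm_eq_abs, abs_sub_comm]
    exact hwz
  have haz : ‖a - z‖ ≤ 2 * ρ := by
    have := norm_sub_le_norm_sub_add_norm_sub a w z
    linarith
  obtain ⟨f, hf, hfd⟩ := exists_linearIsometryEquiv_near_refl han hz (by linarith)
  set g : OrthGroup d := Unitary.linearIsometryEquiv.symm f with hg
  have hgf : Unitary.linearIsometryEquiv g = f := by simp [hg]
  have hrot : Continuous fun V : Grassmannian d n => rotate V g := by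
    refine continuous_induced_rng.mpr ?_
    have h : Grassmannian.proj ∘ (fun V : Grassmannian d n => rotate V g) =
        fun V => (g : EuclideanSpace ℝ (Fin d) →L[ℝ] EuclideanSpace ℝ (Fin d)) * V.proj *
          star (g : EuclideanSpace ℝ (Fin d) →L[ℝ] EuclideanSpace ℝ (Fin d)) := by
      funext V
      ext1 x
      exact Submodule.starProjection_map_apply (Unitary.linearIsometryEquiv g) V.1 x
    rw [h]
    have : Continuous (Grassmannian.proj (d := d) (k := n)) := continuous_induced_dom
    fun_prop
  rw [← grassmannMeasure_preimage_rotate h g (isClosed_nearPlanes h κ δ z).measurableSet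
    ((isClosed_nearPlanes h κ δ z).preimage hrot).measurableSet]
  refine measure_mono ?_
  rintro V ⟨hV1, hV2⟩
  -- `‖a - z‖ ≤ 2ρ` gives displacement `8ρ` and plane distance `16ρ ≤ κ / 2`; hence the bound `κ /
  -- 32` on `ρ`.
  have hdist : dist (rotate V g) V ≤ 2 * (8 * ρ) := by
    rw [Grassmannian.dist_eq]
    have := norm_starProjection_map_sub_le (K := V.1) f (η := 8 * ρ)
      (by have := norm_nonneg (w - z); linarith)
      (fun x => (hfd x).trans (mul_le_mul_of_nonneg_right (by linarith) (norm_nonneg x)))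
    simp only [rotate, hgf]
    exact this
  refine ⟨?_, ?_⟩
  · have := dist_triangle (rotate V g) V (coordPlane h)
    linarith
  · rw [starProjection_rotate, hgf, LinearIsometryEquiv.norm_map,
      show f.symm z = a by rw [← hf, LinearIsometryEquiv.symm_apply_apply], ha, map_smul,
      norm_smul, norm_inv, norm_norm, inv_mul_le_iff₀ hw0]
    nlinarith

theorem starProjection_coordPlane_apply (h : n ≤ d) (x : EuclideanSpace ℝ (Fin d)) (i : Fin d) :
    (coordPlane h).1.starProjection x i = if (i : ℕ) < n then x i else 0 := by
  have key : (coordPlane h).1.starProjection x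
      = WithLp.toLp 2 fun i : Fin d => if (i : ℕ) < n then x i else 0 := by
    apply Submodule.eq_starProjection_of_mem_orthogonal
    · have : (WithLp.toLp 2 fun i : Fin d => if (i : ℕ) < n then x i else 0)
          = ∑ i : Fin n, x (Fin.castLE h i) •
            EuclideanSpace.single (Fin.castLE h i) (1 : ℝ) := by
        ext j
        simp only [WithLp.ofLp_sum, Finset.sum_apply, PiLp.smul_apply, PiLp.single_apply,
          smul_eq_mul, mul_ite, mul_one, mul_zero]
        split_ifs with hj
        · rw [Finset.sum_eq_single (⟨j, hj⟩ : Fin n)]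
          · simp
          · intro b _ hb
            rw [if_neg]
            rintro rfl
            exact hb rfl
          · simp
        · refine (Finset.sum_eq_zero fun b _ => if_neg ?_).symm
          rintro rfl
          exact hj b.2
      rw [this]
      exact Submodule.sum_mem _ fun i _ => Submodule.smul_mem _ _
        (Submodule.subset_span (mem_range_self i))
    · rw [Submodule.mem_orthogonal]
      intro u hu
      induction hu using Submodule.span_induction with
      | mem u hu =>
        obtain ⟨i, rfl⟩ := hu
        simp [EuclideanSpace.inner_single_left]
      | zero => simp
      | add u v _ _ hu hv => rw [inner_add_left, hu, hv, add_zero]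
      | smul a u _ hu => rw [inner_smul_left, hu, mul_zero]
  rw [key]

theorem norm_le_of_forall_abs_le {x : EuclideanSpace ℝ (Fin d)} {s : ℝ}
    (hx : ∀ i, |x i| ≤ s / (d + 1)) (hs : 0 ≤ s) : ‖x‖ ≤ s := by
  have : x = ∑ i, EuclideanSpace.single i (x i) := by
    ext j; simp [WithLp.ofLp_sum]
  rw [this]
  refine (norm_sum_le _ _).trans ?_
  calc ∑ i, ‖EuclideanSpace.single i (x i)‖ ≤ ∑ i : Fin d, s / (d + 1) :=
        Finset.sum_le_sum fun i _ => by simpa using hx i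
    _ = d * (s / (d + 1)) := by simp
    _ ≤ s := by
      rw [mul_div_assoc', div_le_iff₀ (by positivity)]
      nlinarith

/-- A ball contains a product of an `n`-dimensional box of size `δ` around the origin of `ℝⁿ` and a
`(d - n)`-dimensional box of size `ρ`. -/
theorem le_volume_slab (h : n ≤ d) {ρ δ : ℝ} (hδ : 0 < δ) (hδρ : δ ≤ ρ / 2)
    {a : EuclideanSpace ℝ (Fin d)} (ha : ‖(coordPlane h).1.starProjection a‖ ≤ ρ / 4) :
    ENNReal.ofReal ((δ / (d + 1)) ^ n * (ρ / (d + 1)) ^ (d - n)) ≤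
      volume {w : EuclideanSpace ℝ (Fin d) |
        ‖w - a‖ ≤ ρ ∧ ‖(coordPlane h).1.starProjection w‖ ≤ δ / 2} := by
  -- A coordinate box: the first `n` sides are centred at `0`, where the slab is, the others at `a`.
  -- The first `n` coordinates of `a` cost at most `ρ / 4`. Dividing by `d + 1` turns coordinate
  -- bounds into a norm bound.
  set l : Fin d → ℝ := fun i => if (i : ℕ) < n then (δ / 2) / (d + 1) else (ρ / 2) / (d + 1)
  set c : Fin d → ℝ := fun i => if (i : ℕ) < n then 0 else a i
  set B : Set (Fin d → ℝ) := Set.pi univ fun i => Icc (c i - l i) (c i + l i) with hB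
  have hBm : MeasurableSet B := MeasurableSet.univ_pi fun i => measurableSet_Icc
  have hvol : volume B = ENNReal.ofReal ((δ / (d + 1)) ^ n * (ρ / (d + 1)) ^ (d - n)) := by
    rw [hB, volume_pi_pi]
    simp only [Real.volume_Icc]
    rw [← ENNReal.ofReal_prod_of_nonneg]
    · congr 1
      have : ∀ i : Fin d, c i + l i - (c i - l i)
          = if (i : ℕ) < n then δ / (d + 1) else ρ / (d + 1) := by
        intro i
        simp only [l]
        split_ifs <;> ring
      simp only [this]
      rw [Finset.prod_ite, Finset.prod_const, Finset.prod_const]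
      have h1 : (Finset.univ.filter fun i : Fin d => (i : ℕ) < n).card = n := by
        rw [Fin.card_filter_val_lt]; omega
      have h2 := Finset.card_filter_add_card_filter_not (s := (Finset.univ : Finset (Fin d)))
        (fun i : Fin d => (i : ℕ) < n)
      rw [h1, Finset.card_univ, Fintype.card_fin] at h2
      rw [h1, show (Finset.univ.filter fun i : Fin d => ¬ (i : ℕ) < n).card = d - n by omega]
    · intro i _
      have : 0 ≤ l i := by
        simp only [l]; split_ifs <;> (have : 0 < ρ := by linarith) <;> positivity
      linarith
  rw [← hvol, ← (EuclideanSpace.volume_preserving_symm_measurableEquiv_toLp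
    (Fin d)).measure_preimage hBm.nullMeasurableSet]
  refine measure_mono fun w hw => ?_
  have hw' : ∀ i, |w i - c i| ≤ l i := fun i => by
    obtain ⟨h1, h2⟩ : c i - l i ≤ w i ∧ w i ≤ c i + l i := hw i (mem_univ i)
    exact abs_le.2 ⟨by linarith, by linarith⟩
  have hπ : ‖(coordPlane h).1.starProjection w‖ ≤ δ / 2 := by
    refine norm_le_of_forall_abs_le (fun i => ?_) (by positivity)
    rw [starProjection_coordPlane_apply]
    split_ifs with hi
    · simpa [c, l, hi] using hw' i
    · simp; positivity
  refine ⟨?_, hπ⟩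
  have hq : ‖(w - a) - (coordPlane h).1.starProjection (w - a)‖ ≤ ρ / 2 := by
    refine norm_le_of_forall_abs_le (fun i => ?_) (by linarith)
    rw [PiLp.sub_apply, starProjection_coordPlane_apply]
    have : 0 < ρ := by linarith
    split_ifs with hi
    · simp; positivity
    · simpa [c, l, hi] using hw' i
  have h3 : ‖(coordPlane h).1.starProjection (w - a)‖ ≤ δ / 2 + ρ / 4 := by
    rw [map_sub]
    exact (norm_sub_le _ _).trans (add_le_add hπ ha)
  have h4 := norm_add_le ((w - a) - (coordPlane h).1.starProjection (w - a))
    ((coordPlane h).1.starProjection (w - a))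
  rw [sub_add_cancel] at h4
  linarith

theorem le_volume_slab_rotate (h : n ≤ d) {ρ δ : ℝ} (hδ : 0 < δ) (hδρ : δ ≤ ρ / 2)
    {z : EuclideanSpace ℝ (Fin d)} (g : OrthGroup d)
    (hz : ‖(rotate (coordPlane h) g).1.starProjection z‖ ≤ ρ / 4) :
    ENNReal.ofReal ((δ / (d + 1)) ^ n * (ρ / (d + 1)) ^ (d - n)) ≤
      volume {w : EuclideanSpace ℝ (Fin d) |
        ‖w - z‖ ≤ ρ ∧ ‖(rotate (coordPlane h) g).1.starProjection w‖ ≤ δ / 2} := by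
  set f := Unitary.linearIsometryEquiv g with hf
  rw [starProjection_rotate, LinearIsometryEquiv.norm_map] at hz
  refine (le_volume_slab h hδ hδρ hz).trans_eq ?_
  rw [← f.symm.measurePreserving.measure_preimage]
  · congr 1
    ext w
    simp only [mem_preimage, mem_ofPred_eq, starProjection_rotate, LinearIsometryEquiv.norm_map,
      ← map_sub, ← hf]
  · refine IsClosed.nullMeasurableSet ?_
    have h1 : Continuous fun w => ‖w - f.symm z‖ := by fun_prop
    have h2 : Continuous fun w => ‖(coordPlane h).1.starProjection w‖ := by fun_prop
    exact (isClosed_le h1 continuous_const).inter (isClosed_le h2 continuous_const)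

/-- Lower bound for the measure of the planes near `ℝⁿ` that are almost orthogonal to a
vector `z` in a narrow cone around the orthogonal complement of `ℝⁿ`. -/
theorem exists_le_grassmannMeasure_nearPlanes (h : n ≤ d) {κ ρ : ℝ} (hρ0 : 0 < ρ)
    (hρ : ρ ≤ κ / 32) (hρ' : ρ ≤ 1 / 4) :
    ∃ c : ℝ, 0 < c ∧ ∀ z : EuclideanSpace ℝ (Fin d),
      ‖(coordPlane h).1.starProjection z‖ ≤ ρ / 8 * ‖z‖ → ∀ δ : ℝ, 0 < δ → δ ≤ ρ / 2 * ‖z‖ →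
        ENNReal.ofReal (c * (δ / ‖z‖) ^ n) ≤ grassmannMeasure h (nearPlanes h κ δ z) := by
  set U : Set (Grassmannian d n) := closedBall (coordPlane h) (ρ / 8) with hU
  have hrc := rotate_continuous (coordPlane h)
  have hUpos : 0 < grassmannMeasure h U := by
    refine lt_of_lt_of_le ?_ (measure_mono ball_subset_closedBall)
    rw [grassmannMeasure, Measure.map_apply hrc.measurable isOpen_ball.measurableSet]
    refine (isOpen_ball.preimage hrc).measure_pos _ ⟨1, ?_⟩
    rw [mem_preimage, rotate_one]
    exact mem_ball_self (by positivity)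
  set b : ℝ := (grassmannMeasure h U).toReal with hb
  have hb0 : 0 < b := ENNReal.toReal_pos hUpos.ne' (measure_ne_top _ _)
  set v : ℝ := (volume (closedBall (0 : EuclideanSpace ℝ (Fin d)) ρ)).toReal with hv
  have hv0 : 0 < v := ENNReal.toReal_pos (measure_closedBall_pos _ _ hρ0).ne'
    measure_closedBall_lt_top.ne
  refine ⟨b * ((1 / (d + 1)) ^ n * (ρ / (d + 1)) ^ (d - n)) / v, by positivity, ?_⟩
  suffices key : ∀ z : EuclideanSpace ℝ (Fin d), ‖z‖ = 1 →
      ‖(coordPlane h).1.starProjection z‖ ≤ ρ / 8 → ∀ δ : ℝ, 0 < δ → δ ≤ ρ / 2 →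
        ENNReal.ofReal (b * ((1 / (d + 1)) ^ n * (ρ / (d + 1)) ^ (d - n)) / v * δ ^ n) ≤
          grassmannMeasure h (nearPlanes h κ δ z) by
    intro z hz δ hδ hδz
    have hz0 : 0 < ‖z‖ := by
      by_contra hcon
      nlinarith
    have := key (‖z‖⁻¹ • z) (by rw [norm_smul, norm_inv, norm_norm, inv_mul_cancel₀ hz0.ne'])
      (by rw [map_smul, norm_smul, norm_inv, norm_norm, inv_mul_le_iff₀ hz0]; linarith)
      (δ / ‖z‖) (by positivity) (by rwa [div_le_iff₀ hz0])
    refine this.trans_eq ?_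
    congr 1
    ext V
    simp only [nearPlanes, mem_ofPred_eq, map_smul, norm_smul, norm_inv, norm_norm]
    rw [inv_mul_le_iff₀ hz0, mul_div_cancel₀ _ hz0.ne']
  intro z hz hzπ δ hδ hδρ
  -- The measure of `nearPlanes` at the single vector `z` is compared with an average over `w` in a
  -- ball around `z`. Slicing `S` at `w` bounds it above, by rotating `w` to `z`; slicing at a plane
  -- `V` in `U` bounds it below, because the slab around `V^⊥` fills a part of the ball of order
  -- `δⁿ`.
  set S : Set (EuclideanSpace ℝ (Fin d) × Grassmannian d n) :=
    {p | ‖p.1 - z‖ ≤ ρ ∧ dist p.2 (coordPlane h) ≤ κ / 2 ∧ ‖p.2.1.starProjection p.1‖ ≤ δ / 2}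
    with hS
  have hSc : IsClosed S := by
    have h1 : Continuous fun p : EuclideanSpace ℝ (Fin d) × Grassmannian d n => ‖p.1 - z‖ := by
      fun_prop
    have h2 : Continuous fun p : EuclideanSpace ℝ (Fin d) × Grassmannian d n =>
      dist p.2 (coordPlane h) := by fun_prop
    exact (isClosed_le h1 continuous_const).inter ((isClosed_le h2 continuous_const).inter
      (isClosed_le (continuous_starProjection_apply.comp continuous_swap).norm continuous_const))
  have hupper : (volume.prod (grassmannMeasure h)) S ≤
      ENNReal.ofReal v * grassmannMeasure h (nearPlanes h κ δ z) := by
    rw [Measure.prod_apply hSc.measurableSet]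
    calc ∫⁻ w, grassmannMeasure h (Prod.mk w ⁻¹' S)
        ≤ ∫⁻ w, (closedBall z ρ).indicator
            (fun _ => grassmannMeasure h (nearPlanes h κ δ z)) w := by
          refine lintegral_mono fun w => ?_
          by_cases hw : w ∈ closedBall z ρ
          · rw [indicator_of_mem hw]
            rw [mem_closedBall, dist_eq_norm] at hw
            refine le_trans (measure_mono ?_) (grassmannMeasure_nearPlanes_le h hρ hρ' hz hw)
            exact fun V hV => hV.2
          · rw [indicator_of_notMem hw]
            rw [mem_closedBall, dist_eq_norm] at hw
            have : Prod.mk w ⁻¹' S = ∅ := by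
              ext V; simp [hS, hw]
            simp [this]
      _ = ENNReal.ofReal v * grassmannMeasure h (nearPlanes h κ δ z) := by
          rw [lintegral_indicator isClosed_closedBall.measurableSet, setLIntegral_const, mul_comm]
          congr 1
          rw [hv, ENNReal.ofReal_toReal measure_closedBall_lt_top.ne]
          exact Measure.addHaar_closedBall_center _ _ _
  have hlower : ENNReal.ofReal b *
      ENNReal.ofReal ((δ / (d + 1)) ^ n * (ρ / (d + 1)) ^ (d - n)) ≤
      (volume.prod (grassmannMeasure h)) S := by
    rw [Measure.prod_apply_symm hSc.measurableSet, hb, ENNReal.ofReal_toReal (measure_ne_top _ _),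
      mul_comm, ← setLIntegral_const, grassmannMeasure]
    rw [setLIntegral_map isClosed_closedBall.measurableSet measurable_const hrc.measurable,
      lintegral_map (measurable_measure_prodMk_right hSc.measurableSet) hrc.measurable,
      ← lintegral_indicator (hrc.measurable isClosed_closedBall.measurableSet)]
    refine lintegral_mono fun g => ?_
    by_cases hg : rotate (coordPlane h) g ∈ U
    · rw [indicator_of_mem (by exact hg)]
      have hg' : dist (rotate (coordPlane h) g) (coordPlane h) ≤ ρ / 8 := hg
      have hzg := norm_starProjection_le_add_dist (rotate (coordPlane h) g) (coordPlane h) z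
      rw [hz, mul_one] at hzg
      refine (le_volume_slab_rotate h hδ hδρ (z := z) g (by linarith)).trans (measure_mono ?_)
      rintro w ⟨hw1, hw2⟩
      exact ⟨hw1, by linarith, hw2⟩
    · rw [indicator_of_notMem (by exact hg)]
      exact zero_le
  have hfin := hlower.trans hupper
  rw [← ENNReal.ofReal_mul hb0.le] at hfin
  have hv0' : ENNReal.ofReal v ≠ 0 := by simpa using hv0
  have := ENNReal.div_le_of_le_mul' hfin
  rw [← ENNReal.ofReal_div_of_pos hv0] at this
  refine le_trans (le_of_eq ?_) this
  congr 1
  rw [div_pow, div_pow, div_pow, one_pow]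
  ring

end GrassmannMeasure

end BigPieces

/-! ### Schur's test. -/

theorem ENNReal.two_mul_mul_le_sq_add_sq (a b : ℝ≥0∞) : 2 * (a * b) ≤ a ^ 2 + b ^ 2 := by
  wlog hab : a ≤ b generalizing a b
  · rw [mul_comm a b, add_comm]
    exact this b a (le_of_not_ge hab)
  obtain ⟨c, rfl⟩ := exists_add_of_le hab
  calc 2 * (a * (a + c)) ≤ 2 * (a * (a + c)) + c ^ 2 := le_self_add
    _ = _ := by ring

/-- Schur's test for the averaging kernel: a measure with density `f` satisfies
`∫ ν(B(v,δ)) dν(v) ≤ K ‖f‖₂²`, where `K` bounds the measure of balls of radius `δ`. -/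
theorem lintegral_withDensity_closedBall_le {X : Type*} [PseudoMetricSpace X]
    [SecondCountableTopology X] [MeasurableSpace X] [BorelSpace X] (ν : Measure X) [SFinite ν]
    {f : X → ℝ≥0∞} (hf : Measurable f) {δ : ℝ} {K : ℝ≥0∞}
    (hK : ∀ v, ν (closedBall v δ) ≤ K) :
    ∫⁻ v, (ν.withDensity f) (closedBall v δ) ∂(ν.withDensity f) ≤ K * ∫⁻ v, f v ^ 2 ∂ν := by
  set S : Set (X × X) := {p | dist p.2 p.1 ≤ δ} with hS
  have hSm : MeasurableSet S := by
    have : Continuous fun p : X × X => dist p.2 p.1 := by fun_prop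
    exact (isClosed_le this continuous_const).measurableSet
  have hsec : ∀ (φ : X × X → ℝ≥0∞) v, ∫⁻ w in closedBall v δ, φ (v, w) ∂ν
      = ∫⁻ w, S.indicator φ (v, w) ∂ν := by
    intro φ v
    rw [← lintegral_indicator isClosed_closedBall.measurableSet]
    rfl
  have h1 : ∀ φ : X → ℝ≥0∞, Measurable φ →
      ∫⁻ p, S.indicator (fun p => φ p.1) p ∂(ν.prod ν) ≤ K * ∫⁻ v, φ v ∂ν := by
    intro φ hφ
    rw [lintegral_prod _ (by fun_prop (disch := exact hSm)), ← lintegral_const_mul _ hφ]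
    refine lintegral_mono fun v => ?_
    change ∫⁻ w, S.indicator (fun p => φ p.1) (v, w) ∂ν ≤ _
    rw [← hsec (fun p => φ p.1) v]
    change ∫⁻ _ in closedBall v δ, φ v ∂ν ≤ _
    rw [setLIntegral_const, mul_comm]
    gcongr
    exact hK v
  have h2 : ∀ φ : X → ℝ≥0∞, Measurable φ →
      ∫⁻ p, S.indicator (fun p => φ p.2) p ∂(ν.prod ν) ≤ K * ∫⁻ v, φ v ∂ν := by
    intro φ hφ
    rw [← lintegral_prod_swap]
    refine le_trans (le_of_eq ?_) (h1 φ hφ)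
    refine lintegral_congr fun p => ?_
    simp only [indicator, hS, Prod.fst_swap, Prod.snd_swap, mem_ofPred_eq]
    rw [dist_comm]
  have h3 : ∫⁻ v, (ν.withDensity f) (closedBall v δ) ∂(ν.withDensity f)
      = ∫⁻ p, S.indicator (fun p => f p.1 * f p.2) p ∂(ν.prod ν) := by
    have hball : ∀ v, closedBall v δ = Prod.mk v ⁻¹' S := fun v => rfl
    have hfm : Measurable fun v => (ν.withDensity f) (closedBall v δ) := by
      simp only [hball]
      exact measurable_measure_prodMk_left hSm
    rw [lintegral_withDensity_eq_lintegral_mul _ hf hfm,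
      lintegral_prod _ (by fun_prop (disch := exact hSm))]
    refine lintegral_congr fun v => ?_
    rw [← hsec (fun p => f p.1 * f p.2) v, Pi.mul_apply,
      withDensity_apply _ isClosed_closedBall.measurableSet]
    exact (lintegral_const_mul _ hf).symm
  rw [h3]
  -- Pointwise `2 f(v) f(w) ≤ f(v)² + f(w)²`; the kernel is symmetric, so both squares contribute at
  -- most `K ∫ f²`.
  have h4 : 2 * ∫⁻ p, S.indicator (fun p => f p.1 * f p.2) p ∂(ν.prod ν)
      ≤ 2 * (K * ∫⁻ v, f v ^ 2 ∂ν) := by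
    calc 2 * ∫⁻ p, S.indicator (fun p => f p.1 * f p.2) p ∂(ν.prod ν)
        = ∫⁻ p, 2 * S.indicator (fun p => f p.1 * f p.2) p ∂(ν.prod ν) :=
          (lintegral_const_mul _ (by fun_prop (disch := exact hSm))).symm
      _ ≤ ∫⁻ p, (S.indicator (fun p => f p.1 ^ 2) p + S.indicator (fun p => f p.2 ^ 2) p)
            ∂(ν.prod ν) := by
          refine lintegral_mono fun p => ?_
          by_cases hp : p ∈ S
          · simp only [indicator_of_mem hp]
            exact ENNReal.two_mul_mul_le_sq_add_sq (f p.1) (f p.2)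
          · simp [indicator_of_notMem hp]
      _ = _ := lintegral_add_left (by fun_prop (disch := exact hSm)) _
      _ ≤ _ := by
          rw [two_mul]
          exact add_le_add (h1 _ (hf.pow_const 2)) (h2 _ (hf.pow_const 2))
  exact (ENNReal.mul_le_mul_iff_right (by norm_num) (by norm_num)).1 h4

/-! ### The conical energy. -/

namespace BigPieces

section Energy

variable {d n : ℕ}

instance (V : Grassmannian d n) :
    (Measure.hausdorffMeasure (n : ℝ) : Measure V.1).IsAddHaarMeasure := by
  have := isAddHaarMeasure_hausdorffMeasure (E := V.1)
  rwa [V.2] at this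

/-- The `n`-dimensional Hausdorff measure of the unit ball of `ℝⁿ`. -/
noncomputable def unitBallMeasure (n : ℕ) : ℝ≥0∞ :=
  Measure.hausdorffMeasure (n : ℝ) (closedBall (0 : EuclideanSpace ℝ (Fin n)) 1)

theorem unitBallMeasure_lt_top (n : ℕ) : unitBallMeasure n < ∞ := by
  have := isAddHaarMeasure_hausdorffMeasure (E := EuclideanSpace ℝ (Fin n))
  rw [finrank_euclideanSpace_fin] at this
  exact measure_closedBall_lt_top

/-- `V` is isometric to `ℝⁿ`, so the constant does not depend on the plane. -/
theorem hausdorffMeasure_closedBall (V : Grassmannian d n) (v : V.1) {δ : ℝ} (hδ : 0 ≤ δ) :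
    Measure.hausdorffMeasure (n : ℝ) (closedBall v δ)
      = ENNReal.ofReal (δ ^ n) * unitBallMeasure n := by
  rw [Measure.addHaar_closedBall' _ _ hδ, V.2]
  congr 1
  set f := ((stdOrthonormalBasis ℝ V.1).reindex (finCongr V.2)).repr with hf
  rw [unitBallMeasure, ← f.toIsometryEquiv.hausdorffMeasure_image]
  congr 1
  have := f.toIsometryEquiv.image_closedBall (0 : V.1) 1
  rw [this]
  simp

/-- With `ν` the projected measure, the left side is `∫ ν(B(v, δ)) dν(v)`. Absolute continuity makes
`ν` its density times `ℋⁿ`, and Schur's test applies. -/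
theorem prod_starProjection_le_le {E : Set (EuclideanSpace ℝ (Fin d))}
    (hE : Measure.hausdorffMeasure (n : ℝ) E < ∞) {V : Grassmannian d n} (hV : ProjMemL2 E V)
    {δ : ℝ} (hδ : 0 ≤ δ) :
    (((Measure.hausdorffMeasure (n : ℝ)).restrict E).prod
        ((Measure.hausdorffMeasure (n : ℝ)).restrict E))
      {p | ‖V.1.starProjection (p.1 - p.2)‖ ≤ δ} ≤
      ENNReal.ofReal (δ ^ n) * unitBallMeasure n * projL2NormSq E V := by
  have hfin : IsFiniteMeasure ((Measure.hausdorffMeasure (n : ℝ)).restrict E) :=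
    ⟨by rwa [Measure.restrict_apply_univ]⟩
  have hπ : Measurable V.1.orthogonalProjectionOnto := by fun_prop
  have hfin' : IsFiniteMeasure (projMeasure E V) := by
    unfold projMeasure; infer_instance
  have h1 := lintegral_withDensity_closedBall_le
    (Measure.hausdorffMeasure (n : ℝ) : Measure V.1)
    (f := (projMeasure E V).rnDeriv (Measure.hausdorffMeasure (n : ℝ)))
    (Measure.measurable_rnDeriv _ _) (δ := δ)
    (fun v => (hausdorffMeasure_closedBall V v hδ).le)
  rw [Measure.withDensity_rnDeriv_eq _ _ hV.1] at h1
  refine le_trans (le_of_eq ?_) h1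
  have hS : MeasurableSet {p : EuclideanSpace ℝ (Fin d) × EuclideanSpace ℝ (Fin d) |
      ‖V.1.starProjection (p.1 - p.2)‖ ≤ δ} := by
    have : Continuous fun p : EuclideanSpace ℝ (Fin d) × EuclideanSpace ℝ (Fin d) =>
      ‖V.1.starProjection (p.1 - p.2)‖ := by fun_prop
    exact (isClosed_le this continuous_const).measurableSet
  have hS' : MeasurableSet {p : V.1 × V.1 | dist p.2 p.1 ≤ δ} := by
    have : Continuous fun p : V.1 × V.1 => dist p.2 p.1 := by fun_prop
    exact (isClosed_le this continuous_const).measurableSet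
  have hm : Measurable fun v => projMeasure E V (closedBall v δ) :=
    measurable_measure_prodMk_left (ν := projMeasure E V) hS'
  rw [Measure.prod_apply hS]
  have hmap : ∫⁻ v, projMeasure E V (closedBall v δ) ∂(projMeasure E V)
      = ∫⁻ x, projMeasure E V (closedBall (V.1.orthogonalProjectionOnto x) δ)
        ∂((Measure.hausdorffMeasure (n : ℝ)).restrict E) := lintegral_map hm hπ
  rw [hmap]
  refine lintegral_congr fun x => ?_
  rw [projMeasure, Measure.map_apply hπ isClosed_closedBall.measurableSet]
  congr 1
  ext y
  simp only [mem_preimage, mem_ofPred_eq, mem_closedBall]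
  rw [dist_comm, dist_eq_norm, ← map_sub]
  rfl

theorem measurableSet_starProjection_le (δ : ℝ) :
    MeasurableSet {q : Grassmannian d n ×
        (EuclideanSpace ℝ (Fin d) × EuclideanSpace ℝ (Fin d)) |
      ‖q.1.1.starProjection (q.2.1 - q.2.2)‖ ≤ δ} := by
  have h1 : Continuous fun q : Grassmannian d n ×
      (EuclideanSpace ℝ (Fin d) × EuclideanSpace ℝ (Fin d)) => (q.1, q.2.1 - q.2.2) := by
    fun_prop
  exact (isClosed_le (continuous_starProjection_apply.comp h1).norm
    continuous_const).measurableSet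

/-- Fubini exchanges the plane with the pair of points, after which the bound for a single plane is
integrated. -/
theorem lintegral_nearPlanes_le (h : n ≤ d) {κ : ℝ} {C : ℝ≥0∞}
    {E : Set (EuclideanSpace ℝ (Fin d))}
    (hE : Measure.hausdorffMeasure (n : ℝ) E < ∞)
    (hL2 : ∀ᵐ V ∂(grassmannMeasure h).restrict (closedBall (coordPlane h) κ), ProjMemL2 E V)
    (hC : ∫⁻ V in closedBall (coordPlane h) κ, projL2NormSq E V ∂(grassmannMeasure h) ≤ C)
    {δ : ℝ} (hδ : 0 ≤ δ) :
    ∫⁻ p, grassmannMeasure h (nearPlanes h κ δ (p.1 - p.2))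
      ∂(((Measure.hausdorffMeasure (n : ℝ)).restrict E).prod
        ((Measure.hausdorffMeasure (n : ℝ)).restrict E)) ≤
      ENNReal.ofReal (δ ^ n) * unitBallMeasure n * C := by
  have hfin : IsFiniteMeasure ((Measure.hausdorffMeasure (n : ℝ)).restrict E) :=
    ⟨by rwa [Measure.restrict_apply_univ]⟩
  set μ := (Measure.hausdorffMeasure (n : ℝ)).restrict E
  set γ := (grassmannMeasure h).restrict (closedBall (coordPlane h) κ) with hγ
  have hSm := measurableSet_starProjection_le (d := d) (n := n) δ
  calc ∫⁻ p, grassmannMeasure h (nearPlanes h κ δ (p.1 - p.2)) ∂(μ.prod μ)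
      = (γ.prod (μ.prod μ)) {q | ‖q.1.1.starProjection (q.2.1 - q.2.2)‖ ≤ δ} := by
        rw [Measure.prod_apply_symm hSm]
        refine lintegral_congr fun p => ?_
        rw [hγ, Measure.restrict_apply (hSm.preimage (by fun_prop))]
        congr 1
        ext V
        exact and_comm
    _ = ∫⁻ V, (μ.prod μ) {p | ‖V.1.starProjection (p.1 - p.2)‖ ≤ δ} ∂γ :=
        Measure.prod_apply hSm
    _ ≤ ∫⁻ V, ENNReal.ofReal (δ ^ n) * unitBallMeasure n * projL2NormSq E V ∂γ :=
        lintegral_mono_ae (hL2.mono fun V hV => prod_starProjection_le_le hE hV hδ)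
    _ = ENNReal.ofReal (δ ^ n) * unitBallMeasure n * ∫⁻ V, projL2NormSq E V ∂γ :=
        lintegral_const_mul' _ _
          (ENNReal.mul_ne_top ENNReal.ofReal_ne_top (unitBallMeasure_lt_top n).ne)
    _ ≤ _ := by gcongr

/-- The pairs of points whose difference lies in the cone of aperture `θ` around `(ℝⁿ)^⊥`. -/
def conePairs (h : n ≤ d) (θ : ℝ) : Set (EuclideanSpace ℝ (Fin d) × EuclideanSpace ℝ (Fin d)) :=
  {p | p.1 ≠ p.2 ∧ ‖(coordPlane h).1.starProjection (p.1 - p.2)‖ ≤ θ * ‖p.1 - p.2‖}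

theorem measurableSet_conePairs (h : n ≤ d) (θ : ℝ) : MeasurableSet (conePairs h θ) := by
  have h1 : Continuous fun p : EuclideanSpace ℝ (Fin d) × EuclideanSpace ℝ (Fin d) =>
    ‖(coordPlane h).1.starProjection (p.1 - p.2)‖ := by fun_prop
  have h2 : Continuous fun p : EuclideanSpace ℝ (Fin d) × EuclideanSpace ℝ (Fin d) =>
    θ * ‖p.1 - p.2‖ := by fun_prop
  exact (isClosed_eq continuous_fst continuous_snd).measurableSet.compl.inter
    (isClosed_le h1 h2).measurableSet

/-- The conical energy of a set with square-integrable projections to the planes near `ℝⁿ` is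
bounded. -/
theorem exists_lintegral_conePairs_le (h : n ≤ d) {κ ρ : ℝ} (hρ0 : 0 < ρ)
    (hρ : ρ ≤ κ / 32) (hρ' : ρ ≤ 1 / 4) (C : ℝ≥0) :
    ∃ K : ℝ≥0, ∀ E : Set (EuclideanSpace ℝ (Fin d)), Measure.hausdorffMeasure (n : ℝ) E < ∞ →
      (∀ᵐ V ∂(grassmannMeasure h).restrict (closedBall (coordPlane h) κ), ProjMemL2 E V) →
      ∫⁻ V in closedBall (coordPlane h) κ, projL2NormSq E V ∂(grassmannMeasure h) ≤ C →
      ∫⁻ p in conePairs h (ρ / 8), ENNReal.ofReal ((‖p.1 - p.2‖ ^ n)⁻¹)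
        ∂(((Measure.hausdorffMeasure (n : ℝ)).restrict E).prod
          ((Measure.hausdorffMeasure (n : ℝ)).restrict E)) ≤ K := by
  obtain ⟨c, hc0, hc⟩ := exists_le_grassmannMeasure_nearPlanes h hρ0 hρ hρ'
  have hK : unitBallMeasure n * C / ENNReal.ofReal c ≠ ∞ :=
    ENNReal.div_ne_top (ENNReal.mul_ne_top (unitBallMeasure_lt_top n).ne ENNReal.coe_ne_top)
      (by simpa using hc0)
  refine ⟨(unitBallMeasure n * C / ENNReal.ofReal c).toNNReal, fun E hE hL2 hC => ?_⟩
  rw [ENNReal.coe_toNNReal hK]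
  set μ := (Measure.hausdorffMeasure (n : ℝ)).restrict E
  have hcont : Continuous fun p : EuclideanSpace ℝ (Fin d) × EuclideanSpace ℝ (Fin d) =>
      ‖p.1 - p.2‖ := by fun_prop
  -- On `S k` the pairs are far enough apart for the lower bound on `nearPlanes` to hold with `δ = 1
  -- / (k + 1)`. The bound obtained does not depend on `k`, as `δ ^ n` cancels, so monotone
  -- convergence gives the whole cone.
  set S : ℕ → Set (EuclideanSpace ℝ (Fin d) × EuclideanSpace ℝ (Fin d)) :=
    fun k => conePairs h (ρ / 8) ∩ {p | 1 / ((k : ℝ) + 1) ≤ ρ / 2 * ‖p.1 - p.2‖} with hS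
  have hSm : ∀ k, MeasurableSet (S k) := fun k => (measurableSet_conePairs h _).inter
    (isClosed_le continuous_const (continuous_const.mul hcont)).measurableSet
  have hmono : Monotone S := by
    intro k l hkl p hp
    exact ⟨hp.1, (Nat.one_div_le_one_div hkl).trans (mem_ofPred_eq ▸ hp.2)⟩
  have hunion : conePairs h (ρ / 8) = ⋃ k, S k := by
    rw [hS, ← inter_iUnion]
    refine (inter_eq_left.2 fun p hp => ?_).symm
    have : 0 < ρ / 2 * ‖p.1 - p.2‖ :=
      mul_pos (by positivity) (norm_pos_iff.2 (sub_ne_zero.2 hp.1))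
    obtain ⟨k, hk⟩ := exists_nat_one_div_lt this
    exact mem_iUnion.2 ⟨k, hk.le⟩
  rw [hunion, setLIntegral_iUnion_of_directed _ hmono.directed_le]
  refine iSup_le fun k => ?_
  set δ : ℝ := 1 / ((k : ℝ) + 1) with hδ
  have hδ0 : 0 < δ := by positivity
  rw [ENNReal.le_div_iff_mul_le (Or.inl (by simpa using hc0)) (Or.inl ENNReal.ofReal_ne_top)]
  have hδn : ENNReal.ofReal (δ ^ n) ≠ 0 := by simpa using pow_pos hδ0 n
  rw [← ENNReal.mul_le_mul_iff_right hδn ENNReal.ofReal_ne_top,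
    ← mul_assoc (ENNReal.ofReal _) (unitBallMeasure n)]
  refine le_trans ?_ (lintegral_nearPlanes_le h hE hL2 hC hδ0.le)
  rw [mul_comm, mul_assoc, ← ENNReal.ofReal_mul hc0.le,
    ← lintegral_mul_const' _ _ ENNReal.ofReal_ne_top]
  refine le_trans ?_ (setLIntegral_le_lintegral (S k) _)
  refine setLIntegral_mono' (hSm k) fun p hp => ?_
  refine le_trans (le_of_eq ?_) (hc (p.1 - p.2) hp.1.2 δ hδ0 hp.2)
  rw [← ENNReal.ofReal_mul (by positivity)]
  congr 1
  clear_value δ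
  rw [div_pow]
  field_simp

end Energy

end BigPieces

/-! ### Points of low density in subsets of regular sets. -/

namespace BigPieces

section Density

variable {d n : ℕ}

/-- Removes the restriction `R ≤ diam E`: beyond the diameter `D`, the ball of radius `D` already
contains `E`. If `D = 0` the regularity condition is void, but points are null since `n ≥ 1`. -/
theorem IsADR.measure_closedBall_le {C₁ C₂ : ℝ} {E : Set (EuclideanSpace ℝ (Fin d))}
    (hE : IsADR n C₁ C₂ E) (hn : 1 ≤ n) (hC : 0 ≤ C₂) {x : EuclideanSpace ℝ (Fin d)} (hx : x ∈ E)
    {R : ℝ} (hR : 0 < R) :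
    Measure.hausdorffMeasure (n : ℝ) (E ∩ closedBall x R) ≤ ENNReal.ofReal (C₂ * R ^ n) := by
  rcases le_or_gt (ENNReal.ofReal R) (ediam E) with h | h
  · exact (hE x hx R hR h).2
  have htop : ediam E ≠ ∞ := (h.trans ENNReal.ofReal_lt_top).ne
  rcases eq_or_ne (ediam E) 0 with h0 | h0
  · have hs : E.Subsingleton := ediam_eq_zero_iff.1 h0
    have := Measure.nullSingletonClass_hausdorff (EuclideanSpace ℝ (Fin d)) (d := (n : ℝ))
      (by exact_mod_cast hn)
    rw [(hs.anti inter_subset_left).measure_zero]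
    exact zero_le
  · set D := (ediam E).toReal with hD
    have hD0 : 0 < D := ENNReal.toReal_pos h0 htop
    have hDe : ENNReal.ofReal D = ediam E := ENNReal.ofReal_toReal htop
    have hDR : D ≤ R := by
      rw [← hDe] at h
      exact ((ENNReal.ofReal_lt_ofReal_iff hR).1 h).le
    refine le_trans (measure_mono fun y hy => ?_)
      ((hE x hx D hD0 hDe.le).2.trans (ENNReal.ofReal_le_ofReal (by gcongr)))
    refine ⟨hy.1, ?_⟩
    rw [mem_closedBall, dist_edist]
    exact ENNReal.toReal_mono htop (edist_le_ediam_of_mem hy.1 hx)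

/-- The points of `E'` around which `E'` has density less than `ε` at some scale between `0` and the
diameter of `E`. -/
def lowDensityPoints (n : ℕ) (ε : ℝ) (E E' : Set (EuclideanSpace ℝ (Fin d))) :
    Set (EuclideanSpace ℝ (Fin d)) :=
  {y | y ∈ E' ∧ ∃ r : ℝ, 0 < r ∧ r ≤ 2 ∧ ENNReal.ofReal r ≤ ediam E ∧
    Measure.hausdorffMeasure (n : ℝ) (E' ∩ closedBall y r) < ENNReal.ofReal (ε * r ^ n)}

/-- Among the balls `B(y, r/5)` a disjoint family is chosen whose enlargements `B(y, r)` cover the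
bad points. Each enlargement holds less than `ε rⁿ` of `E'`, while `E` has mass at least `C₁ (r/5)ⁿ`
in the small ball. The disjoint balls lie within distance `3` of a bad point, so their total
`E`-mass is at most `C₂ 3ⁿ`. -/
theorem IsADR.measure_lowDensityPoints_le {C₁ C₂ : ℝ} {E E' : Set (EuclideanSpace ℝ (Fin d))}
    (hE : IsADR n C₁ C₂ E) (hn : 1 ≤ n) (hC₁ : 0 < C₁) (hC : C₁ ≤ C₂)
    (hE' : E' ⊆ E ∩ closedBall 0 1) {ε : ℝ} (hε : 0 ≤ ε) :
    Measure.hausdorffMeasure (n : ℝ) (lowDensityPoints n ε E E') ≤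
      ENNReal.ofReal (ε * 5 ^ n / C₁ * (C₂ * 3 ^ n)) := by
  rcases (lowDensityPoints n ε E E').eq_empty_or_nonempty with hemp | ⟨x₀, hx₀⟩
  · simp [hemp]
  have hex : ∀ y, ∃ r : ℝ, y ∈ lowDensityPoints n ε E E' → 0 < r ∧ r ≤ 2 ∧
      ENNReal.ofReal r ≤ ediam E ∧
      Measure.hausdorffMeasure (n : ℝ) (E' ∩ closedBall y r) < ENNReal.ofReal (ε * r ^ n) := by
    intro y
    by_cases hy : y ∈ lowDensityPoints n ε E E'
    · obtain ⟨r, hr⟩ := hy.2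
      exact ⟨r, fun _ => hr⟩
    · exact ⟨0, fun h => absurd h hy⟩
  choose r hr using hex
  obtain ⟨u, hut, hudisj, hucov⟩ :=
    Vitali.exists_disjoint_subfamily_covering_enlargement_closedBall
      (lowDensityPoints n ε E E') id (fun y => r y / 5) (2 / 5)
      (fun y hy => by have := (hr y hy).2.1; linarith) 5 (by norm_num)
  have hucount : u.Countable := by
    refine hudisj.countable_of_nonempty_interior fun y hy => ?_
    have h0 : 0 < r y / 5 := by have := (hr y (hut hy)).1; positivity
    exact ⟨y, ball_subset_interior_closedBall (mem_ball_self h0)⟩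
  have hcover : lowDensityPoints n ε E E' ⊆ ⋃ y ∈ u, E' ∩ closedBall y (r y) := by
    intro y hy
    obtain ⟨b, hb, hyb⟩ := hucov y hy
    have h0 : 0 ≤ r y / 5 := by have := (hr y hy).1; positivity
    have := hyb (mem_closedBall_self h0)
    simp only [id, mul_div_cancel₀ (r b) (by norm_num : (5 : ℝ) ≠ 0)] at this
    exact mem_biUnion hb ⟨hy.1, this⟩
  have := hucount.to_subtype
  set K : ℝ≥0∞ := ENNReal.ofReal (ε * 5 ^ n / C₁)
  calc Measure.hausdorffMeasure (n : ℝ) (lowDensityPoints n ε E E')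
      ≤ ∑' y : u, Measure.hausdorffMeasure (n : ℝ) (E' ∩ closedBall (y : _) (r y)) :=
        (measure_mono hcover).trans (measure_biUnion_le _ hucount _)
    _ ≤ ∑' y : u, K * ((Measure.hausdorffMeasure (n : ℝ)).restrict E)
          (closedBall (y : _) (r y / 5)) := by
        refine ENNReal.tsum_le_tsum fun y => ?_
        obtain ⟨h0, h2, hdiam, hlt⟩ := hr y (hut y.2)
        have h1 := (hE y (hE' (hut y.2).1).1 (r y / 5) (by positivity)
          ((ENNReal.ofReal_le_ofReal (by linarith)).trans hdiam)).1
        rw [Measure.restrict_apply isClosed_closedBall.measurableSet, inter_comm _ E]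
        refine hlt.le.trans (le_trans (le_of_eq ?_) (mul_le_mul_right h1 K))
        rw [← ENNReal.ofReal_mul (by positivity)]
        congr 1
        rw [div_pow]
        field_simp
    _ = K * ((Measure.hausdorffMeasure (n : ℝ)).restrict E)
          (⋃ y ∈ u, closedBall (y : _) (r y / 5)) := by
        rw [ENNReal.tsum_mul_left]
        congr 1
        exact (measure_biUnion hucount hudisj
          fun y _ => isClosed_closedBall.measurableSet).symm
    _ ≤ K * ENNReal.ofReal (C₂ * 3 ^ n) := by
        gcongr
        have hx₀E := hE' hx₀.1
        refine le_trans ?_ (hE.measure_closedBall_le hn (hC₁.le.trans hC) hx₀E.1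
          (by norm_num : (0 : ℝ) < 3))
        rw [Measure.restrict_apply (MeasurableSet.biUnion hucount
          fun y _ => isClosed_closedBall.measurableSet)]
        refine measure_mono ?_
        rintro z ⟨hz, hzE⟩
        refine ⟨hzE, ?_⟩
        obtain ⟨y, hy, hzy⟩ := mem_iUnion₂.1 hz
        have h1 : dist z y ≤ r y / 5 := hzy
        have h2 : dist y 0 ≤ 1 := (hE' (hut hy).1).2
        have h3 : dist x₀ 0 ≤ 1 := hx₀E.2
        have h4 := (hr y (hut hy)).2.1
        rw [mem_closedBall]
        have h5 := dist_triangle4 z y 0 x₀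
        rw [dist_comm 0 x₀] at h5
        linarith
    _ = _ := (ENNReal.ofReal_mul (by positivity)).symm

end Density

/-! ### Counting the scales at which a cone meets the set. -/

section Counting

variable {d n : ℕ}

/-- Two admissible powers of `2` differ by a factor of at most `8 = 2³`, so the exponents lie among
four consecutive integers. -/
theorem card_filter_dyadic_le (t : Finset ℤ) (τ : ℝ) :
    (t.filter fun j : ℤ => (2 : ℝ) ^ (-j) / 4 ≤ τ ∧ τ ≤ 2 * (2 : ℝ) ^ (-j)).card ≤ 4 := by
  set s := t.filter fun j : ℤ => (2 : ℝ) ^ (-j) / 4 ≤ τ ∧ τ ≤ 2 * (2 : ℝ) ^ (-j) with hs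
  rcases s.eq_empty_or_nonempty with h | h
  · simp [h]
  have hsub : s ⊆ Finset.Icc (s.min' h) (s.min' h + 3) := by
    intro j hj
    refine Finset.mem_Icc.2 ⟨s.min'_le j hj, ?_⟩
    have h1 := (Finset.mem_filter.1 (s.min'_mem h)).2
    have h2 := (Finset.mem_filter.1 hj).2
    have h3 : (2 : ℝ) ^ (-(s.min' h)) ≤ (2 : ℝ) ^ (3 + -j) := by
      rw [zpow_add₀ (by norm_num), show (2 : ℝ) ^ (3 : ℤ) = 8 by norm_num]
      linarith [h1.1, h2.2]
    rw [zpow_le_zpow_iff_right₀ (by norm_num)] at h3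
    omega
  refine (Finset.card_le_card hsub).trans ?_
  rw [Int.card_Icc]
  omega

/-- If a measure has large density around the points of `E`, then every scale at which the cone at
`x` meets `E` contributes to the conical energy at `x`. -/
theorem encard_scales_le (h : n ≤ d) {θ ε M : ℝ} (hθ : 0 < θ) (hθ' : θ ≤ 1) (hε : 0 < ε)
    (μ : Measure (EuclideanSpace ℝ (Fin d))) (E : Set (EuclideanSpace ℝ (Fin d)))
    (x : EuclideanSpace ℝ (Fin d))
    (hM : ∫⁻ y in {y | (x, y) ∈ conePairs h θ}, ENNReal.ofReal ((‖x - y‖ ^ n)⁻¹) ∂μ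
      ≤ ENNReal.ofReal M)
    (hE : ∀ y ∈ E, ∀ r, 0 < r → r ≤ ‖x - y‖ → ENNReal.ofReal (ε * r ^ n) ≤ μ (closedBall y r)) :
    {j : ℤ | (coneAnnulus x (coordPlane h).1ᗮ (θ / 2) ((2 : ℝ) ^ (-j)) ((2 : ℝ) ^ (-j - 1))
      ∩ E).Nonempty}.encard ≤ (⌈4 * M / (ε * (θ / 32) ^ n)⌉₊ : ℕ) := by
  set J := {j : ℤ | (coneAnnulus x (coordPlane h).1ᗮ (θ / 2) ((2 : ℝ) ^ (-j)) ((2 : ℝ) ^ (-j - 1))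
      ∩ E).Nonempty} with hJ
  set e : ℝ := ε * (θ / 32) ^ n with he
  have he0 : 0 < e := by positivity
  set S : Set (EuclideanSpace ℝ (Fin d)) := {y | (x, y) ∈ conePairs h θ} with hS
  have hSm : MeasurableSet S := (measurableSet_conePairs h θ).preimage measurable_prodMk_left
  set k : EuclideanSpace ℝ (Fin d) → ℝ≥0∞ :=
    S.indicator fun y => ENNReal.ofReal ((‖x - y‖ ^ n)⁻¹) with hk
  have hkm : Measurable k := Measurable.indicator (by fun_prop) hSm
  set A : ℤ → Set (EuclideanSpace ℝ (Fin d)) :=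
    fun j => {y | (2 : ℝ) ^ (-j) / 4 ≤ ‖x - y‖ ∧ ‖x - y‖ ≤ 2 * (2 : ℝ) ^ (-j)} with hA
  have hAm : ∀ j, MeasurableSet (A j) := fun j => by
    have hc : Continuous fun y => ‖x - y‖ := by fun_prop
    exact ((isClosed_le continuous_const hc).inter (isClosed_le hc continuous_const)).measurableSet
  -- The ball of radius `θs/16` around `y` stays in the cone of aperture `θ` and in the thickened
  -- annulus `A j`. There the kernel is at least `(2s)⁻ⁿ` and the mass at least `ε (θs/16)ⁿ`; the
  -- product is `e`, independent of `s`.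
  have hlow : ∀ j ∈ J, ENNReal.ofReal e ≤ ∫⁻ y, (A j).indicator k y ∂μ := by
    rintro j ⟨y, ⟨hcone, hout, hin⟩, hyE⟩
    set s : ℝ := (2 : ℝ) ^ (-j) with hs
    have hs0 : 0 < s := by positivity
    have hxy1 : ‖x - y‖ ≤ s := by
      rw [← dist_eq_norm, dist_comm]; exact hout
    have hxy2 : s / 2 ≤ ‖x - y‖ := by
      rw [← dist_eq_norm, dist_comm]
      rw [mem_ball, not_lt, zpow_sub_one₀ (by norm_num)] at hin
      exact hin
    have hcone' : ‖(coordPlane h).1.starProjection (x - y)‖ ≤ θ / 2 * ‖x - y‖ := by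
      have h1 : ‖(coordPlane h).1ᗮᗮ.starProjection (x - y)‖ ≤ θ / 2 * ‖x - y‖ := hcone
      simpa only [Submodule.orthogonal_orthogonal] using h1
    have hr0 : 0 < θ / 16 * s := by positivity
    have hrs : θ / 16 * s ≤ s / 16 := by nlinarith
    have hball : ∀ y' ∈ closedBall y (θ / 16 * s), ENNReal.ofReal (((2 * s) ^ n)⁻¹) ≤
        (A j).indicator k y' := by
      intro y' hy'
      have h1 : ‖y - y'‖ ≤ θ / 16 * s := by rw [← dist_eq_norm, dist_comm]; exact hy'
      have h2 : ‖x - y'‖ ≤ ‖x - y‖ + ‖y - y'‖ := norm_sub_le_norm_sub_add_norm_sub _ _ _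
      have h3 : ‖x - y‖ ≤ ‖x - y'‖ + ‖y' - y‖ := norm_sub_le_norm_sub_add_norm_sub _ _ _
      rw [norm_sub_rev y' y] at h3
      have hpos : 0 < ‖x - y'‖ := by linarith
      have hyA : y' ∈ A j := ⟨by change s / 4 ≤ _; linarith, by change _ ≤ 2 * s; linarith⟩
      have hyS : y' ∈ S := by
        refine ⟨fun hxy => ?_, ?_⟩
        · rw [show x = y' from hxy, sub_self, norm_zero] at hpos
          exact lt_irrefl _ hpos
        · change ‖(coordPlane h).1.starProjection (x - y')‖ ≤ θ * ‖x - y'‖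
          have h4 : x - y' = (x - y) + (y - y') := by abel
          have h5 : ‖(coordPlane h).1.starProjection (x - y')‖ ≤
              θ / 2 * ‖x - y‖ + θ / 16 * s := by
            rw [h4, map_add]
            exact (norm_add_le _ _).trans (add_le_add hcone'
              (((coordPlane h).1.norm_starProjection_apply_le _).trans h1))
          have h6 : s ≤ 4 * ‖x - y'‖ := by linarith
          have h7 : θ / 2 * ‖x - y‖ ≤ θ / 2 * (‖x - y'‖ + s / 16) := by
            gcongr; linarith
          nlinarith
      rw [indicator_of_mem hyA, hk, indicator_of_mem hyS]
      refine ENNReal.ofReal_le_ofReal ?_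
      gcongr
      linarith
    calc ENNReal.ofReal e = ENNReal.ofReal (((2 * s) ^ n)⁻¹)
          * ENNReal.ofReal (ε * (θ / 16 * s) ^ n) := by
          rw [← ENNReal.ofReal_mul (by positivity)]
          congr 1
          rw [he, ← inv_pow, mul_left_comm, ← mul_pow]
          congr 2
          field_simp
          norm_num
      _ ≤ ENNReal.ofReal (((2 * s) ^ n)⁻¹) * μ (closedBall y (θ / 16 * s)) := by
          gcongr
          exact hE y hyE _ hr0 (by linarith)
      _ = ∫⁻ _ in closedBall y (θ / 16 * s), ENNReal.ofReal (((2 * s) ^ n)⁻¹) ∂μ :=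
          (setLIntegral_const _ _).symm
      _ ≤ ∫⁻ y' in closedBall y (θ / 16 * s), (A j).indicator k y' ∂μ :=
          setLIntegral_mono' isClosed_closedBall.measurableSet hball
      _ ≤ _ := setLIntegral_le_lintegral _ _
  -- A finite subset with one scale too many suffices, so finiteness of `J` need not be known
  -- beforehand.
  by_contra hcon
  rw [not_le] at hcon
  have hcon' : ((⌈4 * M / e⌉₊ + 1 : ℕ) : ℕ∞) ≤ J.encard := by
    push_cast
    exact Order.add_one_le_of_lt hcon
  obtain ⟨t, htJ, ht⟩ := exists_subset_encard_eq hcon'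
  have htfin : t.Finite := finite_of_encard_eq_coe ht
  lift t to Finset ℤ using htfin
  rw [encard_coe_eq_coe_finsetCard, Nat.cast_inj] at ht
  have hsum : (t.card : ℝ≥0∞) * ENNReal.ofReal e ≤ 4 * ENNReal.ofReal M := by
    calc (t.card : ℝ≥0∞) * ENNReal.ofReal e = ∑ _j ∈ t, ENNReal.ofReal e := by simp
      _ ≤ ∑ j ∈ t, ∫⁻ y, (A j).indicator k y ∂μ :=
          Finset.sum_le_sum fun j hj => hlow j (htJ hj)
      _ = ∫⁻ y, ∑ j ∈ t, (A j).indicator k y ∂μ :=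
          (lintegral_finsetSum _ fun j _ => hkm.indicator (hAm j)).symm
      _ ≤ ∫⁻ y, 4 * k y ∂μ := by
          refine lintegral_mono fun y => ?_
          have h1 : ∑ j ∈ t, (A j).indicator k y
              = ((t.filter fun j : ℤ => (2 : ℝ) ^ (-j) / 4 ≤ ‖x - y‖ ∧
                ‖x - y‖ ≤ 2 * (2 : ℝ) ^ (-j)).card : ℝ≥0∞) * k y := by
            rw [← nsmul_eq_mul, ← Finset.sum_const, Finset.sum_filter]
            refine Finset.sum_congr rfl fun j _ => ?_
            simp only [indicator, hA, mem_ofPred_eq]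
          dsimp only
          rw [h1]
          gcongr
          exact_mod_cast card_filter_dyadic_le t ‖x - y‖
      _ = 4 * ∫⁻ y, k y ∂μ := lintegral_const_mul _ hkm
      _ ≤ _ := by
          gcongr
          rwa [hk, lintegral_indicator hSm]
  -- `ENNReal.ofReal` truncates negative numbers, so positivity of `M` must be derived before
  -- returning to real numbers.
  have hM0 : 0 < M := by
    by_contra hM0
    rw [ENNReal.ofReal_of_nonpos (not_lt.1 hM0), mul_zero, nonpos_iff_eq_zero, mul_eq_zero] at hsum
    rcases hsum with h | h
    · rw [ht] at h
      exact Nat.succ_ne_zero (⌈4 * M / e⌉₊) (by exact_mod_cast h)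
    · exact absurd (ENNReal.ofReal_eq_zero.1 h) (not_le.2 he0)
  rw [← ENNReal.ofReal_natCast, ← ENNReal.ofReal_mul (by positivity),
    show (4 : ℝ≥0∞) = ENNReal.ofReal 4 by norm_num, ← ENNReal.ofReal_mul (by norm_num),
    ENNReal.ofReal_le_ofReal_iff (by positivity), ← le_div_iff₀ he0, ht] at hsum
  have := Nat.le_ceil (4 * M / e)
  push_cast at hsum
  linarith

end Counting

end BigPieces

/-! ### Assembly of the proof. -/

theorem mainTheorem4 (d : ℕ) (κ : ℝ) (hκ : 0 < κ) :
    ∃ θ₀ : ℝ, 0 < θ₀ ∧ θ₀ < 1 ∧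
      ∀ (n : ℕ) (_ : 1 ≤ n) (hnd : n < d) (C₁ C₂ : ℝ) (_ : 0 < C₁) (_ : C₁ ≤ C₂) (C : ℝ≥0),
        ∃ (M₀ : ℕ) (A : ℝ), 0 < A ∧
          ∀ E₀ E₁ : Set (EuclideanSpace ℝ (Fin d)),
            BigPieces.IsADR n C₁ C₂ E₀ →
            E₁ ⊆ E₀ ∩ closedBall 0 1 →
            NullMeasurableSet E₁ (Measure.hausdorffMeasure (n : ℝ)) →
            ENNReal.ofReal κ ≤ Measure.hausdorffMeasure (n : ℝ) E₁ →
            (∀ᵐ V ∂(BigPieces.grassmannMeasure hnd.le).restrict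
                (closedBall (BigPieces.coordPlane hnd.le) κ), BigPieces.ProjMemL2 E₁ V) →
            ∫⁻ V in closedBall (BigPieces.coordPlane hnd.le) κ, BigPieces.projL2NormSq E₁ V
                ∂(BigPieces.grassmannMeasure hnd.le) ≤ C →
            ∃ E₂ ⊆ E₁,
              NullMeasurableSet E₂ (Measure.hausdorffMeasure (n : ℝ)) ∧
              ENNReal.ofReal A⁻¹ ≤ Measure.hausdorffMeasure (n : ℝ) E₂ ∧
              Measure.hausdorffMeasure (n : ℝ) E₂ ≤ ENNReal.ofReal A ∧
              BigPieces.ThetaMProperty hnd.le θ₀ M₀ E₂ := by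
  set ρ : ℝ := min (κ / 32) (1 / 4) with hρdef
  have hρ0 : 0 < ρ := by positivity
  have hρ1 : ρ ≤ κ / 32 := min_le_left _ _
  have hρ2 : ρ ≤ 1 / 4 := min_le_right _ _
  -- The energy is bounded for aperture `ρ / 8`; half of it leaves room for balls around points of
  -- the narrower cone.
  refine ⟨ρ / 8 / 2, by positivity, by linarith, ?_⟩
  intro n hn hnd C₁ C₂ hC₁ hC₁₂ C
  obtain ⟨K, hK⟩ := BigPieces.exists_lintegral_conePairs_le hnd.le hρ0 hρ1 hρ2 C
  have hC₂ : 0 < C₂ := hC₁.trans_le hC₁₂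
  -- Chebyshev then discards measure at most `K / M ≤ κ / 2`; the `+ 1` keeps `M` positive.
  set M : ℝ := 2 * (K + 1) / κ with hM
  have hM0 : 0 < M := by positivity
  -- Chosen so that the bound for the low-density points is exactly `κ / 4`.
  set ε : ℝ := κ / 4 * C₁ / (5 ^ n * (C₂ * 3 ^ n)) with hε
  have hε0 : 0 < ε := by positivity
  refine ⟨⌈4 * M / (ε * (ρ / 8 / 32) ^ n)⌉₊, max (C₂ * 3 ^ n) (4 / κ),
    lt_max_of_lt_right (by positivity), ?_⟩
  intro E₀ E₁ hE₀ hE₁₀ hE₁m hκE₁ hL2 hC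
  set H : Measure (EuclideanSpace ℝ (Fin d)) := Measure.hausdorffMeasure (n : ℝ) with hH
  obtain ⟨x₀, hx₀⟩ : E₁.Nonempty := by
    by_contra hcon
    rw [not_nonempty_iff_eq_empty.1 hcon, measure_empty] at hκE₁
    simp at hκE₁
    linarith
  have hHE₁ : H E₁ ≤ ENNReal.ofReal (C₂ * 3 ^ n) := by
    refine le_trans (measure_mono fun y hy => ?_)
      (hE₀.measure_closedBall_le hn hC₂.le (hE₁₀ hx₀).1 (by norm_num : (0 : ℝ) < 3))
    refine ⟨(hE₁₀ hy).1, ?_⟩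
    have h1 : dist y 0 ≤ 1 := (hE₁₀ hy).2
    have h2 : dist x₀ 0 ≤ 1 := (hE₁₀ hx₀).2
    have h3 := dist_triangle_right y x₀ 0
    rw [mem_closedBall]
    linarith
  have hfinE₁ : H E₁ < ∞ := hHE₁.trans_lt ENNReal.ofReal_lt_top
  have henergy := hK E₁ hfinE₁ hL2 hC
  -- `E₁` is only null-measurable; a Borel subset of full measure carries the same energy.
  obtain ⟨F, hFE₁, hFm, hFae⟩ := hE₁m.exists_measurable_subset_ae_eq
  rw [← Measure.restrict_congr_set hFae] at henergy
  have hHF : H F = H E₁ := measure_congr hFae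
  set μ := H.restrict F with hμ
  have hμfin : IsFiniteMeasure μ := ⟨by rwa [hμ, Measure.restrict_apply_univ, hHF]⟩
  have hconem := BigPieces.measurableSet_conePairs (d := d) hnd.le (ρ / 8)
  set g : EuclideanSpace ℝ (Fin d) → ℝ≥0∞ := fun x =>
    ∫⁻ y in {y | (x, y) ∈ BigPieces.conePairs hnd.le (ρ / 8)},
      ENNReal.ofReal ((‖x - y‖ ^ n)⁻¹) ∂μ with hg
  have hkm : Measurable ((BigPieces.conePairs (d := d) hnd.le (ρ / 8)).indicator
      fun p => ENNReal.ofReal ((‖p.1 - p.2‖ ^ n)⁻¹)) :=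
    Measurable.indicator (by fun_prop) hconem
  have hg' : ∀ x, g x = ∫⁻ y, (BigPieces.conePairs (d := d) hnd.le (ρ / 8)).indicator
      (fun p => ENNReal.ofReal ((‖p.1 - p.2‖ ^ n)⁻¹)) (x, y) ∂μ := fun x => by
    exact (lintegral_indicator (hconem.preimage measurable_prodMk_left) _).symm
  have hgm : Measurable g := by
    rw [funext hg']
    exact hkm.lintegral_prod_right'
  have hgint : ∫⁻ x, g x ∂μ ≤ K := by
    rw [lintegral_congr hg', ← lintegral_prod _ hkm.aemeasurable, lintegral_indicator hconem]
    exact henergy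
  set E' := F ∩ {x | g x < ENNReal.ofReal M} with hE'
  have hE'm : MeasurableSet E' := hFm.inter (measurableSet_lt hgm measurable_const)
  have hE'F : E' ⊆ F := inter_subset_left
  have hbig : ENNReal.ofReal (κ / 2) ≤ H E' := by
    have h1 : ENNReal.ofReal M * μ {x | ENNReal.ofReal M ≤ g x} ≤ K :=
      (mul_meas_ge_le_lintegral hgm _).trans hgint
    have h2 : μ {x | ENNReal.ofReal M ≤ g x} ≤ ENNReal.ofReal (κ / 2) := by
      rw [← ENNReal.mul_le_mul_iff_right (a := ENNReal.ofReal M) (by simpa using hM0)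
        ENNReal.ofReal_ne_top]
      refine h1.trans ?_
      rw [← ENNReal.ofReal_mul hM0.le, ← ENNReal.ofReal_coe_nnreal]
      refine ENNReal.ofReal_le_ofReal ?_
      rw [hM]
      field_simp
      linarith
    have h3 : H F ≤ H E' + μ {x | ENNReal.ofReal M ≤ g x} := by
      rw [hμ, Measure.restrict_apply (measurableSet_le measurable_const hgm)]
      refine le_trans (measure_mono fun x hx => ?_) (measure_union_le _ _)
      rcases lt_or_ge (g x) (ENNReal.ofReal M) with h | h
      · exact Or.inl ⟨hx, h⟩
      · exact Or.inr ⟨h, hx⟩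
    have h4 : ENNReal.ofReal (κ / 2) + ENNReal.ofReal (κ / 2)
        ≤ H E' + ENNReal.ofReal (κ / 2) := by
      rw [← ENNReal.ofReal_add (by positivity) (by positivity), add_halves]
      exact (hκE₁.trans hHF.ge).trans (h3.trans (by gcongr))
    exact (ENNReal.add_le_add_iff_right ENNReal.ofReal_ne_top).1 h4
  have hE'E₀ : E' ⊆ E₀ ∩ closedBall 0 1 := (hE'F.trans hFE₁).trans hE₁₀
  set B := BigPieces.lowDensityPoints n ε E₀ E' with hB
  have hHB : H B ≤ ENNReal.ofReal (κ / 4) := by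
    refine (hE₀.measure_lowDensityPoints_le hn hC₁ hC₁₂ hE'E₀ hε0.le).trans_eq ?_
    congr 1
    rw [hε]
    field_simp
  -- The measurable hull of `B` has the same measure. Removing it does not spoil the density at the
  -- remaining points, which is that of `E'`.
  set E₂ := E' \ toMeasurable H B with hE₂
  have hE₂E₁ : E₂ ⊆ E₁ := sdiff_subset.trans (hE'F.trans hFE₁)
  refine ⟨E₂, hE₂E₁, (hE'm.diff (measurableSet_toMeasurable _ _)).nullMeasurableSet, ?_, ?_, ?_⟩
  · have h1 : H E' ≤ H E₂ + H (toMeasurable H B) :=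
      (measure_mono (by rw [hE₂, sdiff_union_self]; exact subset_union_left)).trans
        (measure_union_le _ _)
    rw [measure_toMeasurable] at h1
    have h2 : ENNReal.ofReal (κ / 4) + ENNReal.ofReal (κ / 4)
        ≤ H E₂ + ENNReal.ofReal (κ / 4) := by
      rw [← ENNReal.ofReal_add (by positivity) (by positivity),
        show κ / 4 + κ / 4 = κ / 2 by ring]
      exact hbig.trans (h1.trans (by gcongr))
    refine le_trans (ENNReal.ofReal_le_ofReal ?_)
      ((ENNReal.add_le_add_iff_right ENNReal.ofReal_ne_top).1 h2)
    rw [inv_le_comm₀ (lt_max_of_lt_right (by positivity)) (by positivity), inv_div]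
    exact le_max_right _ _
  · exact (measure_mono hE₂E₁).trans (hHE₁.trans (ENNReal.ofReal_le_ofReal (le_max_left _ _)))
  · intro x hx
    refine BigPieces.encard_scales_le hnd.le (by positivity) (by linarith) hε0 μ E₂ x
      (hx.1.2 : g x < _).le ?_
    -- Both points lie in `E₀` and in the unit ball, so `r ≤ |x - y|` is at most `diam E₀` and at
    -- most `2`, the range of scales in `lowDensityPoints`.
    intro y hy r hr0 hr
    have hxE := hE'E₀ hx.1
    have hyE := hE'E₀ hy.1
    rw [← dist_eq_norm] at hr
    have hr2 : r ≤ 2 := by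
      have h1 : dist x 0 ≤ 1 := hxE.2
      have h2 : dist y 0 ≤ 1 := hyE.2
      have h3 := dist_triangle_right x y 0
      linarith
    have hrd : ENNReal.ofReal r ≤ ediam E₀ := by
      refine le_trans ?_ (edist_le_ediam_of_mem hxE.1 hyE.1)
      rw [edist_dist]
      exact ENNReal.ofReal_le_ofReal hr
    have hyB : y ∉ B := fun h => hy.2 (subset_toMeasurable _ _ h)
    have hle : ENNReal.ofReal (ε * r ^ n) ≤ H (E' ∩ closedBall y r) := by
      by_contra hlt
      exact hyB ⟨hy.1, r, hr0, hr2, hrd, not_le.1 hlt⟩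
    refine hle.trans ?_
    rw [hμ, Measure.restrict_apply isClosed_closedBall.measurableSet, inter_comm]
    exact measure_mono (inter_subset_inter_right _ hE'F)
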